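/- For a positive integer $m$ let $\sigma(m)$ denote the sum of the positive divisors of $m$, and put $\sigma(x)=0$ for every rational number $x$ that is not a positive integer. (In particular $\sigma(m/2)=0$ if $m$ is odd; all the sums below have only finitely many nonzero terms.) Let $n$ be a positive integer. Then the following three recursions hold. (i) $$2n\,\sigma(2n+1)=\sum_{j=1}^{\infty}\bigl(5j(j+1)-2n\bigr)\,\sigma\bigl(2n+1-j(j+1)\bigr).$$ (ii) $$\sum_{j=0}^{\infty}\Bigl(\sigma\bigl(n-\tfrac{j(j+1)}{2}\bigr)-4\,\sigma\bigl(\tfrac12\bigl(n-\tfrac{j(j+1)}{2}\bigr)\bigr)\Bigr)=\begin{cases} n, & \text{if } n=\tfrac{k(k+1)}{2}\text{ for some integer } k\ge 0,\\ 0, & \text{otherwise.}\end{cases}$$ (iii) $$n\,\sigma(2n+1)=4\sum_{j=1}^{\infty}\bigl(\sigma(j)-4\,\sigma(j/2)\bigr)\,\sigma(2n+1-2j).$$ -/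

import Mathlib

/-- The sum of the positive divisors of `x` if `x` is a positive integer, and `0` for every other
rational number `x` (zero, negative or not an integer). -/
def sigmaQ (x : ℚ) : ℤ :=
  if 0 < x ∧ x.den = 1 then ((∑ d ∈ x.num.toNat.divisors, d : ℕ) : ℤ) else 0

/-- On positive integers, `sigmaQ` is the arithmetic function `σ₁`. -/
theorem sigmaQ_natCast (n : ℕ) : sigmaQ (n : ℚ) = (ArithmeticFunction.sigma 1 n : ℤ) := by
  rcases Nat.eq_zero_or_pos n with rfl | hn
  · simp [sigmaQ]
  · have h : (0 : ℚ) < (n : ℚ) := by exact_mod_cast hn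
    simp [sigmaQ, hn, ArithmeticFunction.sigma_one_apply]

/-! For fixed `s`, the pairs `(d, x)` with `s² + kdx = D` are the factorizations of `(D - s²)/k`, so
a sum of values of σ becomes a sum of `d` over triples. Odd `s = ±(2j+1)` produces the shifts by
`j(j+1)`. Recursion (i) uses `D = 8n+5`, `k = 4`; recursion (ii) uses `D = 8n+1` and compares `k =
8` with `k = 16`. For `k = 4` a triple is the indefinite form `dt² + st - x` of discriminant `D`.
Reflections such as `t ↦ 1 - t`, sign changes and swaps permute triples. They make the weighted sum
vanish (`sum_formTriples_four_cubic`) or leave only boundary triples, which force `D` to be a square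
(`sum_formTriples_eight_sub`). Recursion (iii) is then formal. Let `T = ∑ q^(k(k+1)/2)`, `S = ∑
σ(2m+1) q^m`, `P = ∑ (σ(m) - 4σ(m/2)) q^m`, `θ = q d/dq`. Then (i) says `T·θS = 4·θT·S` and (ii)
says `T·P = θT`; cancelling `T` gives `θS = 4PS`. -/

/-! ### Divisor sums as sums over triples -/

/-- The triples `(s, d, x)` with `d, x` positive and `s ^ 2 + k * d * x = D`. -/
noncomputable def formTriples (k D : ℤ) : Finset (ℤ × ℤ × ℤ) :=
  (Finset.Icc (-D) D ×ˢ Finset.Icc 1 D ×ˢ Finset.Icc 1 D).filter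
    (fun p => p.1 ^ 2 + k * p.2.1 * p.2.2 = D)

theorem mem_formTriples {k D : ℤ} (hk : 0 < k) (s d x : ℤ) :
    (s, d, x) ∈ formTriples k D ↔ 0 < d ∧ 0 < x ∧ s ^ 2 + k * d * x = D := by
  simp only [formTriples, Finset.mem_filter, Finset.mem_product, Finset.mem_Icc]
  constructor
  · rintro ⟨⟨_, ⟨hd, _⟩, hx, _⟩, h⟩
    exact ⟨by omega, by omega, h⟩
  · rintro ⟨hd, hx, h⟩
    have h1 : d * x ≤ k * d * x := by nlinarith [mul_pos hd hx]
    have h2 : d ≤ d * x := by nlinarith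
    have h3 : x ≤ d * x := by nlinarith
    have h4 := sq_nonneg s
    refine ⟨⟨⟨?_, ?_⟩, ⟨by omega, by omega⟩, by omega, by omega⟩, h⟩
    · nlinarith
    · nlinarith

theorem sigmaQ_div_eq_sum {k m B : ℤ} (hk : 0 < k) (hB : m ≤ B) :
    sigmaQ ((m : ℚ) / k) =
      ∑ p ∈ (Finset.Icc 1 B ×ˢ Finset.Icc 1 B).filter (fun p => k * p.1 * p.2 = m), p.1 := by
  by_cases h : 0 < m ∧ k ∣ m
  · obtain ⟨hm, q, rfl⟩ := h
    have hq : 0 < q := pos_of_mul_pos_right hm hk.le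
    lift q to ℕ using hq.le
    have hk' : (k : ℚ) ≠ 0 := by exact_mod_cast hk.ne'
    have hcast : (((k * (q : ℤ) : ℤ)) : ℚ) / k = ((q : ℕ) : ℚ) := by
      push_cast
      field_simp
    rw [hcast, sigmaQ_natCast, ArithmeticFunction.sigma_one_apply, Nat.cast_sum]
    have hqB : (q : ℤ) ≤ B := by nlinarith
    refine Finset.sum_bij' (fun d _ => ((d : ℤ), ((q / d : ℕ) : ℤ)))
      (fun p _ => p.1.toNat) ?_ ?_ ?_ ?_ ?_
    · intro d hd
      obtain ⟨hdq, hq0⟩ := Nat.mem_divisors.mp hd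
      obtain ⟨e, rfl⟩ := hdq
      have hd0 : 0 < d := Nat.pos_of_ne_zero (by rintro rfl; simp at hq0)
      have he0 : 0 < e := Nat.pos_of_ne_zero (by rintro rfl; simp at hq0)
      simp only [Finset.mem_filter, Finset.mem_product, Finset.mem_Icc, Nat.mul_div_cancel_left e hd0]
      push_cast at hqB ⊢
      have h1 : (0 : ℤ) < d := by exact_mod_cast hd0
      have h2 : (0 : ℤ) < e := by exact_mod_cast he0
      exact ⟨⟨⟨by omega, by nlinarith⟩, by omega, by nlinarith⟩, by ring⟩
    · rintro ⟨d, x⟩ hp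
      simp only [Finset.mem_filter, Finset.mem_product, Finset.mem_Icc] at hp
      obtain ⟨⟨⟨hd, _⟩, hx, _⟩, he⟩ := hp
      lift d to ℕ using by omega
      lift x to ℕ using by omega
      have he' : d * x = q := by
        have : (d : ℤ) * x = q := mul_left_cancel₀ hk.ne' (by rw [← he]; ring)
        exact_mod_cast this
      exact Nat.mem_divisors.mpr ⟨⟨x, by simp [he']⟩, by omega⟩
    · intro d _
      simp
    · rintro ⟨d, x⟩ hp
      simp only [Finset.mem_filter, Finset.mem_product, Finset.mem_Icc] at hp
      obtain ⟨⟨⟨hd, _⟩, hx, _⟩, he⟩ := hp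
      lift d to ℕ using by omega
      lift x to ℕ using by omega
      have he' : d * x = q := by
        have : (d : ℤ) * x = q := mul_left_cancel₀ hk.ne' (by rw [← he]; ring)
        exact_mod_cast this
      have hd0 : 0 < d := by omega
      simp [← he', Nat.mul_div_cancel_left x hd0]
    · intro d _
      rfl
  · rw [Finset.filter_eq_empty_iff.mpr, Finset.sum_empty]
    · have hk' : (0 : ℚ) < k := by exact_mod_cast hk
      rw [sigmaQ, if_neg]
      rintro ⟨hpos, hden⟩
      refine h ⟨?_, ((m : ℚ) / k).num, ?_⟩
      · have := (div_pos_iff_of_pos_right hk').mp hpos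
        exact_mod_cast this
      · have h1 : (((m : ℚ) / k).num : ℚ) = (m : ℚ) / k := Rat.coe_int_num_of_den_eq_one hden
        have h2 : (m : ℚ) = k * ((m : ℚ) / k).num := by rw [h1]; field_simp
        exact_mod_cast h2
    · rintro ⟨d, x⟩ hp he
      simp only [Finset.mem_product, Finset.mem_Icc] at hp he
      obtain ⟨⟨hd, _⟩, hx, _⟩ := hp
      refine h ⟨?_, d * x, by rw [← he]; ring⟩
      rw [← he]
      have : 0 < d := by omega
      have : 0 < x := by omega
      positivity

theorem sigmaQ_of_nonpos {x : ℚ} (hx : x ≤ 0) : sigmaQ x = 0 := by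
  rw [sigmaQ, if_neg]
  exact fun h => absurd h.1 hx.not_gt

theorem sum_formTriples_eq_sum_sigmaQ {k D : ℤ} (hk : 0 < k) (w : ℤ → ℤ) :
    ∑ p ∈ formTriples k D, w p.1 * p.2.1 =
      ∑ s ∈ Finset.Icc (-D) D, w s * sigmaQ (((D : ℚ) - (s : ℚ) ^ 2) / k) := by
  rw [formTriples, Finset.sum_filter, Finset.sum_product]
  refine Finset.sum_congr rfl fun s _ => ?_
  have h := sigmaQ_div_eq_sum (m := D - s ^ 2) (B := D) hk (by nlinarith [sq_nonneg s])
  push_cast at h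
  rw [h, Finset.sum_filter, Finset.mul_sum]
  refine Finset.sum_congr rfl fun p _ => ?_
  rw [mul_ite, mul_zero]
  exact if_congr ⟨fun h => by simp only at h ⊢; linarith, fun h => by simp only at h ⊢; linarith⟩ rfl rfl

theorem sum_Icc_eq_two_mul_sum_range_odd {h : ℤ → ℤ} (heven : ∀ s, h (-s) = h s)
    (hzero : ∀ t, h (2 * t) = 0) (K : ℕ) :
    ∑ s ∈ Finset.Icc (-(2 * (K : ℤ) + 1)) (2 * (K : ℤ) + 1), h s =
      2 * ∑ j ∈ Finset.range (K + 1), h (2 * (j : ℤ) + 1) := by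
  induction K with
  | zero =>
    have : Finset.Icc (-(2 * ((0 : ℕ) : ℤ) + 1)) (2 * ((0 : ℕ) : ℤ) + 1) = {-1, 0, 1} := by decide
    rw [this]
    simp [heven 1, show h 0 = 0 by simpa using hzero 0, two_mul]
  | succ K ih =>
    have : Finset.Icc (-(2 * ((K + 1 : ℕ) : ℤ) + 1)) (2 * ((K + 1 : ℕ) : ℤ) + 1) =
        insert (-(2 * (K : ℤ) + 3)) (insert (2 * (K : ℤ) + 3)
          (insert (-(2 * ((K : ℤ) + 1))) (insert (2 * ((K : ℤ) + 1))
            (Finset.Icc (-(2 * (K : ℤ) + 1)) (2 * (K : ℤ) + 1))))) := by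
      ext s
      simp only [Finset.mem_Icc, Finset.mem_insert]
      push_cast
      omega
    rw [this, Finset.sum_insert, Finset.sum_insert, Finset.sum_insert, Finset.sum_insert, ih,
      Finset.sum_range_succ _ (K + 1), heven, heven, hzero]
    · push_cast
      rw [show 2 * ((K : ℤ) + 1) + 1 = 2 * K + 3 by ring]
      ring
    all_goals simp only [Finset.mem_insert, Finset.mem_Icc]; omega

/-- The sum over the triples, folded to the positive odd `s`. -/
theorem sum_formTriples_eq_two_mul_sum_range {k : ℤ} (hk : 0 < k) (hk2 : 2 ∣ k) (K : ℕ)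
    {w : ℤ → ℤ} (hw : ∀ s, w (-s) = w s) :
    ∑ p ∈ formTriples k (2 * (K : ℤ) + 1), w p.1 * p.2.1 =
      2 * ∑ j ∈ Finset.range (K + 1),
        w (2 * (j : ℤ) + 1) * sigmaQ ((2 * (K : ℚ) + 1 - (2 * (j : ℚ) + 1) ^ 2) / k) := by
  rw [sum_formTriples_eq_sum_sigmaQ hk, sum_Icc_eq_two_mul_sum_range_odd]
  · push_cast
    rfl
  · intro s
    simp [hw]
  · intro t
    -- For even `s`, `D - s²` is odd while `k` is even, so there are no factorizations.
    have h := sigmaQ_div_eq_sum (m := 2 * (K : ℤ) + 1 - (2 * t) ^ 2) (B := 2 * K + 1) hk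
      (by nlinarith [sq_nonneg (2 * t)])
    rw [Finset.filter_eq_empty_iff.mpr, Finset.sum_empty] at h
    · push_cast at h ⊢
      rw [h, mul_zero]
    · rintro ⟨d, x⟩ _ he
      obtain ⟨l, rfl⟩ := hk2
      simp only at he
      have : 2 * (l * d * x + 2 * t ^ 2 - K) = 1 := by linarith
      omega

/-! ### The case `k = 4` and recursion (i) -/

theorem sum_formTriples_neg {k D : ℤ} (hk : 0 < k) (g : ℤ × ℤ × ℤ → ℤ) :
    ∑ p ∈ formTriples k D, g (-p.1, p.2) = ∑ p ∈ formTriples k D, g p := by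
  refine Finset.sum_nbij' (fun p => (-p.1, p.2)) (fun p => (-p.1, p.2)) ?_ ?_ ?_ ?_ ?_ <;>
    rintro ⟨s, d, x⟩ h <;> simp_all [mem_formTriples hk]

/-- On the forms negative at `1`, exchanging the values at `0` and `1` is an involution. -/
theorem sum_formTriples_four_flip {D : ℤ} (g : ℤ × ℤ × ℤ → ℤ) :
    ∑ p ∈ formTriples 4 D with p.2.1 + p.1 < p.2.2, g (-p.1 - 2 * p.2.1, p.2.1, p.2.2 - p.2.1 - p.1) =
      ∑ p ∈ formTriples 4 D with p.2.1 + p.1 < p.2.2, g p := by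
  refine Finset.sum_nbij' (fun p => (-p.1 - 2 * p.2.1, p.2.1, p.2.2 - p.2.1 - p.1))
    (fun p => (-p.1 - 2 * p.2.1, p.2.1, p.2.2 - p.2.1 - p.1)) ?_ ?_ ?_ ?_ ?_
  all_goals
    rintro ⟨s, d, x⟩ h
    simp only [Finset.mem_filter, mem_formTriples (show (0 : ℤ) < 4 by norm_num)] at h
    obtain ⟨⟨hd, hx, he⟩, hlt⟩ := h
  · simp only [Finset.mem_filter, mem_formTriples (show (0 : ℤ) < 4 by norm_num)]
    exact ⟨⟨hd, by omega, by rw [← he]; ring⟩, by omega⟩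
  · simp only [Finset.mem_filter, mem_formTriples (show (0 : ℤ) < 4 by norm_num)]
    exact ⟨⟨hd, by omega, by rw [← he]; ring⟩, by omega⟩
  · simp only [Prod.mk.injEq]
    exact ⟨by ring, trivial, by ring⟩
  · simp only [Prod.mk.injEq]
    exact ⟨by ring, trivial, by ring⟩
  · rfl

/-- The map `(s, d, x) ↦ (-s, x, d)` exchanges `d + s > x` with `d + s < x`; equality would give `D
= (2d + s)²`. -/
theorem sum_formTriples_four_split {D : ℤ} (hD : ¬ IsSquare D) (g : ℤ × ℤ × ℤ → ℤ) :
    ∑ p ∈ formTriples 4 D, g p =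
      ∑ p ∈ formTriples 4 D with p.2.1 + p.1 < p.2.2, (g p + g (-p.1, p.2.2, p.2.1)) := by
  rw [← Finset.sum_filter_add_sum_filter_not (formTriples 4 D) (fun p => p.2.1 + p.1 < p.2.2),
    Finset.sum_add_distrib]
  congr 1
  refine Finset.sum_nbij' (fun p => (-p.1, p.2.2, p.2.1)) (fun p => (-p.1, p.2.2, p.2.1))
    ?_ ?_ ?_ ?_ ?_
  all_goals
    rintro ⟨s, d, x⟩ h
    simp only [Finset.mem_filter, mem_formTriples (show (0 : ℤ) < 4 by norm_num)] at h
    obtain ⟨⟨hd, hx, he⟩, hlt⟩ := h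
  · simp only [Finset.mem_filter, mem_formTriples (show (0 : ℤ) < 4 by norm_num)]
    refine ⟨⟨hx, hd, by rw [← he]; ring⟩, ?_⟩
    have : d + s ≠ x := by
      rintro rfl
      exact hD ⟨2 * d + s, by rw [← he]; ring⟩
    omega
  · simp only [Finset.mem_filter, mem_formTriples (show (0 : ℤ) < 4 by norm_num)]
    exact ⟨⟨hx, hd, by rw [← he]; ring⟩, by omega⟩
  all_goals simp

theorem sum_formTriples_four_cubic {D : ℤ} (hD : ¬ IsSquare D) :
    ∑ p ∈ formTriples 4 D, (5 * p.1 ^ 2 - D) * p.2.1 = 0 := by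
  have hf : ∑ p ∈ formTriples 4 D, (5 * p.1 ^ 2 - D) * p.2.1 =
      ∑ p ∈ formTriples 4 D, 4 * ((p.1 ^ 2 - p.2.1 * p.2.2) * p.2.1) := by
    refine Finset.sum_congr rfl ?_
    rintro ⟨s, d, x⟩ h
    obtain ⟨_, _, he⟩ := (mem_formTriples (by norm_num) s d x).mp h
    simp only
    rw [← he]
    ring
  -- With `y = x - d - s`, the flip exchanges `x` and `y`, and this weight changes by
  -- `(d+s)(d+x)(x-s) = -(s² - dx)(d+x) + s(x² - d²)`.
  have hu := sum_formTriples_four_flip (D := D) fun p =>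
    (p.2.1 + p.2.2) * (p.2.2 - p.2.1 - p.1) ^ 2 + p.2.1 ^ 2 * (p.2.2 - p.2.1 - p.1)
  -- After folding, this contributes `4s(x² - d²)`, which cancels the unwanted term above.
  have hg := sum_formTriples_neg (k := 4) (D := D) (by norm_num)
    fun p => p.2.2 * (p.2.2 - p.2.1 - p.1) ^ 2
  rw [sum_formTriples_four_split hD, sum_formTriples_four_split hD] at hg
  rw [hf, sum_formTriples_four_split hD]
  rw [← sub_eq_zero, ← Finset.sum_sub_distrib] at hu hg
  rw [← mul_zero (-4 : ℤ), ← hu, Finset.mul_sum, ← sub_zero (Finset.sum _ _), ← hg,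
    ← sub_eq_zero]
  simp only [← Finset.sum_sub_distrib]
  refine Finset.sum_eq_zero fun p _ => ?_
  ring

theorem sum_range_mul_sigmaQ_two_mul_add_one (n : ℕ) :
    ∑ j ∈ Finset.range (4 * n + 3), (5 * (j : ℤ) * ((j : ℤ) + 1) - 2 * (n : ℤ)) *
        sigmaQ (2 * (n : ℚ) + 1 - (j : ℚ) * ((j : ℚ) + 1)) = 0 := by
  -- Here `D = 8n + 5`, and odd squares are 1 mod 8.
  have hns : ¬ IsSquare (2 * ((4 * n + 2 : ℕ) : ℤ) + 1) := by
    rintro ⟨r, hr⟩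
    push_cast at hr
    rcases Int.even_or_odd' r with ⟨t, rfl | rfl⟩
    · ring_nf at hr
      omega
    · obtain ⟨u, hu⟩ := Int.even_mul_succ_self t
      have : 8 * (n : ℤ) + 5 = 8 * u + 1 := by linear_combination hr + 4 * hu
      omega
  have h := sum_formTriples_eq_two_mul_sum_range (k := 4) (by norm_num) (by norm_num) (4 * n + 2)
    (w := fun s => 5 * s ^ 2 - (2 * ((4 * n + 2 : ℕ) : ℤ) + 1)) (by simp)
  rw [sum_formTriples_four_cubic hns, eq_comm, mul_eq_zero, or_iff_right two_ne_zero] at h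
  refine (mul_eq_zero_iff_left (four_ne_zero (α := ℤ))).mp ?_
  rw [Finset.mul_sum, ← h]
  refine Finset.sum_congr rfl fun j _ => ?_
  push_cast
  rw [← mul_assoc]
  congr 1
  · ring
  · congr 1
    ring

/-! ### The cases `k = 8`, `k = 16` and recursion (ii) -/

theorem sum_formTriples_swap {k D : ℤ} (hk : 0 < k) (g : ℤ × ℤ × ℤ → ℤ) :
    ∑ p ∈ formTriples k D, g (p.1, p.2.2, p.2.1) = ∑ p ∈ formTriples k D, g p := by
  refine Finset.sum_nbij' (fun p => (p.1, p.2.2, p.2.1)) (fun p => (p.1, p.2.2, p.2.1))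
    ?_ ?_ ?_ ?_ ?_
  · rintro ⟨s, d, x⟩ h
    obtain ⟨hd, hx, he⟩ := (mem_formTriples hk s d x).mp h
    exact (mem_formTriples hk _ _ _).mpr ⟨hx, hd, by rw [← he]; ring⟩
  · rintro ⟨s, d, x⟩ h
    obtain ⟨hd, hx, he⟩ := (mem_formTriples hk s d x).mp h
    exact (mem_formTriples hk _ _ _).mpr ⟨hx, hd, by rw [← he]; ring⟩
  all_goals simp

/-- The triples with `k = 8` and `x` odd, compared with the triples with `k = 16`. -/
theorem sum_formTriples_eight_odd (D : ℤ) (hD : Odd D) :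
    ∑ p ∈ formTriples 8 D with Odd p.2.2, p.2.2 =
      2 * ∑ p ∈ formTriples 16 D, p.2.1 +
        ∑ p ∈ formTriples 8 D with Odd p.2.2 ∧ p.2.2 = 2 * p.2.1 + p.1, 2 * p.2.1 := by
  have h8 : (0 : ℤ) < 8 := by norm_num
  have h16 : (0 : ℤ) < 16 := by norm_num
  have hodd : ∀ s : ℤ, ∀ m : ℤ, s ^ 2 + 2 * m = D → Odd s := by
    intro s m h
    rw [← Int.not_even_iff_odd]
    rintro ⟨t, rfl⟩
    obtain ⟨r, rfl⟩ := hD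
    have : 2 * (2 * t ^ 2 + m - r) = 1 := by linear_combination h
    omega
  have split : ∀ g : ℤ × ℤ × ℤ → ℤ, ∑ p ∈ formTriples 8 D with Odd p.2.2, g p =
      ∑ p ∈ formTriples 8 D with Odd p.2.2 ∧ p.2.2 = 2 * p.2.1 + p.1, g p +
      (∑ p ∈ formTriples 8 D with Odd p.2.2 ∧ p.2.2 < 2 * p.2.1 + p.1, g p +
      ∑ p ∈ formTriples 8 D with Odd p.2.2 ∧ 2 * p.2.1 + p.1 < p.2.2, g p) := by
    intro g
    simp only [← Finset.filter_filter]
    generalize (formTriples 8 D).filter (fun p => Odd p.2.2) = S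
    simp only [Finset.sum_filter, ← Finset.sum_add_distrib]
    refine Finset.sum_congr rfl fun p _ => ?_
    rcases lt_trichotomy p.2.2 (2 * p.2.1 + p.1) with h | h | h
    · simp [h, h.ne, h.not_gt]
    · simp [h]
    · simp [h, h.ne', h.not_gt]
  -- Since `s` sums to zero, the weight `x` may be replaced by `x - s`.
  have hneg : ∑ p ∈ formTriples 8 D with Odd p.2.2, p.1 = 0 := by
    have := sum_formTriples_neg (D := D) h8 fun p => if Odd p.2.2 then p.1 else 0
    rw [← Finset.sum_filter, ← Finset.sum_filter, Finset.sum_neg_distrib] at this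
    linarith
  -- The reflection `t ↦ -1 - t` of `xt² + st - 2d` negates `x - s`; `s` and `x` are both odd, so
  -- the halving is exact.
  have hplus : ∑ p ∈ formTriples 8 D with Odd p.2.2 ∧ p.2.2 < 2 * p.2.1 + p.1, (p.2.2 - p.1) =
      ∑ p ∈ formTriples 8 D with Odd p.2.2 ∧ p.2.2 < 2 * p.2.1 + p.1, -(p.2.2 - p.1) := by
    refine Finset.sum_nbij' (fun p => (2 * p.2.2 - p.1, p.2.1 + (p.1 - p.2.2) / 2, p.2.2))
      (fun p => (2 * p.2.2 - p.1, p.2.1 + (p.1 - p.2.2) / 2, p.2.2)) ?_ ?_ ?_ ?_ ?_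
    all_goals
      rintro ⟨s, d, x⟩ h
      simp only [Finset.mem_filter, mem_formTriples h8] at h
      obtain ⟨⟨hd, hx, he⟩, hxo, hlt⟩ := h
      obtain ⟨u, rfl⟩ := hodd s (4 * d * x) (by rw [← he]; ring)
      obtain ⟨v, rfl⟩ := hxo
      have e1 : (2 * u + 1 - (2 * v + 1)) / 2 = u - v := by omega
      have e2 : (2 * (2 * v + 1) - (2 * u + 1) - (2 * v + 1)) / 2 = v - u := by omega
      simp only [Finset.mem_filter, mem_formTriples h8, e1, e2, Prod.mk.injEq]
    · exact ⟨⟨by omega, hx, by rw [← he]; ring⟩, ⟨v, rfl⟩, by omega⟩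
    · exact ⟨⟨by omega, hx, by rw [← he]; ring⟩, ⟨v, rfl⟩, by omega⟩
    · exact ⟨by ring, by ring, trivial⟩
    · exact ⟨by ring, by ring, trivial⟩
    · ring
  -- The reflection `t ↦ 1 - t` of `2dt² + st - x` makes the new `x` even; halving it turns `k = 8`
  -- into `k = 16`.
  have hminus : ∑ p ∈ formTriples 8 D with Odd p.2.2 ∧ 2 * p.2.1 + p.1 < p.2.2, (p.2.2 - p.1) =
      ∑ p ∈ formTriples 16 D with 2 * p.2.1 + p.1 < 2 * p.2.2, 2 * (p.2.1 + p.2.2) := by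
    refine Finset.sum_nbij'
      (fun p => (-p.1 - 4 * p.2.1, p.2.1, (p.2.2 - 2 * p.2.1 - p.1) / 2))
      (fun p => (-p.1 - 4 * p.2.1, p.2.1, 2 * p.2.2 - 2 * p.2.1 - p.1)) ?_ ?_ ?_ ?_ ?_
    · rintro ⟨s, d, x⟩ h
      simp only [Finset.mem_filter, mem_formTriples h8] at h
      obtain ⟨⟨hd, hx, he⟩, hxo, hlt⟩ := h
      obtain ⟨u, rfl⟩ := hodd s (4 * d * x) (by rw [← he]; ring)
      obtain ⟨v, rfl⟩ := hxo
      have e1 : (2 * v + 1 - 2 * d - (2 * u + 1)) / 2 = v - d - u := by omega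
      simp only [Finset.mem_filter, mem_formTriples h16, e1]
      exact ⟨⟨hd, by omega, by rw [← he]; ring⟩, by omega⟩
    · rintro ⟨s, d, x⟩ h
      simp only [Finset.mem_filter, mem_formTriples h16] at h
      obtain ⟨⟨hd, hx, he⟩, hlt⟩ := h
      obtain ⟨u, rfl⟩ := hodd s (8 * d * x) (by rw [← he]; ring)
      simp only [Finset.mem_filter, mem_formTriples h8]
      exact ⟨⟨hd, by omega, by rw [← he]; ring⟩, ⟨x - d - u - 1, by ring⟩, by omega⟩
    · rintro ⟨s, d, x⟩ h
      simp only [Finset.mem_filter, mem_formTriples h8] at h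
      obtain ⟨⟨hd, hx, he⟩, hxo, hlt⟩ := h
      obtain ⟨u, rfl⟩ := hodd s (4 * d * x) (by rw [← he]; ring)
      obtain ⟨v, rfl⟩ := hxo
      simp only [Prod.mk.injEq]
      exact ⟨by ring, trivial, by omega⟩
    · rintro ⟨s, d, x⟩ h
      simp only [Prod.mk.injEq]
      exact ⟨by ring, trivial, by omega⟩
    · rintro ⟨s, d, x⟩ h
      simp only [Finset.mem_filter, mem_formTriples h8] at h
      obtain ⟨⟨hd, hx, he⟩, hxo, hlt⟩ := h
      obtain ⟨u, rfl⟩ := hodd s (4 * d * x) (by rw [← he]; ring)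
      obtain ⟨v, rfl⟩ := hxo
      have e1 : (2 * v + 1 - 2 * d - (2 * u + 1)) / 2 = v - d - u := by omega
      simp only [e1]
      ring
  -- `(-s, x, d)` exchanges the two halves; `2d + s = 2x` is impossible for odd `s`.
  have hsixteen : ∑ p ∈ formTriples 16 D, (p.2.1 + p.2.2) =
      ∑ p ∈ formTriples 16 D with 2 * p.2.1 + p.1 < 2 * p.2.2, 2 * (p.2.1 + p.2.2) := by
    rw [← Finset.mul_sum, two_mul, ← Finset.sum_filter_add_sum_filter_not (formTriples 16 D)
      (fun p => 2 * p.2.1 + p.1 < 2 * p.2.2)]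
    congr 1
    refine Finset.sum_nbij' (fun p => (-p.1, p.2.2, p.2.1)) (fun p => (-p.1, p.2.2, p.2.1))
      ?_ ?_ ?_ ?_ ?_
    all_goals
      rintro ⟨s, d, x⟩ h
      simp only [Finset.mem_filter, mem_formTriples h16] at h
      obtain ⟨⟨hd, hx, he⟩, hlt⟩ := h
      obtain ⟨u, rfl⟩ := hodd s (8 * d * x) (by rw [← he]; ring)
      simp only [Finset.mem_filter, mem_formTriples h16, Prod.mk.injEq]
    · exact ⟨⟨hx, hd, by rw [← he]; ring⟩, by omega⟩
    · exact ⟨⟨hx, hd, by rw [← he]; ring⟩, by omega⟩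
    · simp
    · simp
    · ring
  have hswap := sum_formTriples_swap (D := D) h16 fun p => p.2.1
  rw [Finset.sum_add_distrib] at hsixteen
  have hx := split fun p => p.2.2 - p.1
  rw [Finset.sum_sub_distrib, hneg, hminus, ← hsixteen] at hx
  rw [Finset.sum_neg_distrib] at hplus
  have hzero : ∑ p ∈ formTriples 8 D with Odd p.2.2 ∧ p.2.2 = 2 * p.2.1 + p.1, (p.2.2 - p.1) =
      ∑ p ∈ formTriples 8 D with Odd p.2.2 ∧ p.2.2 = 2 * p.2.1 + p.1, 2 * p.2.1 := by
    refine Finset.sum_congr rfl fun p hp => ?_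
    rw [(Finset.mem_filter.mp hp).2.2]
    ring
  simp only at hswap
  linarith

theorem sum_formTriples_eight_even (D : ℤ) :
    ∑ p ∈ formTriples 8 D with ¬ Odd p.2.2, p.2.2 = 2 * ∑ p ∈ formTriples 16 D, p.2.1 := by
  rw [← sum_formTriples_swap (by norm_num) fun p => p.2.1, Finset.mul_sum]
  refine Finset.sum_nbij' (fun p => (p.1, p.2.1, p.2.2 / 2)) (fun p => (p.1, p.2.1, 2 * p.2.2))
    ?_ ?_ ?_ ?_ ?_
  · rintro ⟨s, d, x⟩ h
    simp only [Finset.mem_filter, mem_formTriples (show (0 : ℤ) < 8 by norm_num),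
      Int.not_odd_iff_even] at h
    obtain ⟨⟨hd, hx, he⟩, v, rfl⟩ := h
    rw [mem_formTriples (by norm_num)]
    simp only [show (v + v) / 2 = v by omega]
    exact ⟨hd, by omega, by rw [← he]; ring⟩
  · rintro ⟨s, d, x⟩ h
    rw [mem_formTriples (by norm_num)] at h
    obtain ⟨hd, hx, he⟩ := h
    simp only [Finset.mem_filter, mem_formTriples (show (0 : ℤ) < 8 by norm_num),
      Int.not_odd_iff_even]
    exact ⟨⟨hd, by omega, by rw [← he]; ring⟩, even_two_mul x⟩
  · rintro ⟨s, d, x⟩ h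
    simp only [Finset.mem_filter, Int.not_odd_iff_even] at h
    obtain ⟨_, v, rfl⟩ := h
    simp only [Prod.mk.injEq]
    exact ⟨trivial, trivial, by omega⟩
  · rintro ⟨s, d, x⟩ h
    simp
  · rintro ⟨s, d, x⟩ h
    simp only [Finset.mem_filter, Int.not_odd_iff_even] at h
    obtain ⟨_, v, rfl⟩ := h
    simp only
    omega

/-- After swapping `d` and `x`, even and odd `x` each account for twice the `k = 16` sum; only the
odd part leaves a boundary. -/
theorem sum_formTriples_eight_sub (D : ℤ) (hD : Odd D) :
    ∑ p ∈ formTriples 8 D, p.2.1 - 4 * ∑ p ∈ formTriples 16 D, p.2.1 =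
        ∑ p ∈ formTriples 8 D with Odd p.2.2 ∧ p.2.2 = 2 * p.2.1 + p.1, 2 * p.2.1 := by
  have h := sum_formTriples_swap (D := D) (show (0 : ℤ) < 8 by norm_num) fun p => p.2.1
  simp only at h
  rw [← h, ← Finset.sum_filter_add_sum_filter_not (formTriples 8 D) (fun p => Odd p.2.2),
    sum_formTriples_eight_odd D hD, sum_formTriples_eight_even]
  ring

/-- On the boundary `x = 2d + s`, `D = (4d + s)²`. -/
theorem sum_formTriples_eight_boundary_eq_zero {D : ℤ} (hD : ¬ IsSquare D) :
    ∑ p ∈ formTriples 8 D with Odd p.2.2 ∧ p.2.2 = 2 * p.2.1 + p.1, 2 * p.2.1 = 0 := by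
  rw [Finset.filter_eq_empty_iff.mpr, Finset.sum_empty]
  rintro ⟨s, d, x⟩ h ⟨_, hx⟩
  rw [mem_formTriples (by norm_num)] at h
  simp only at hx
  exact hD ⟨4 * d + s, by rw [← h.2.2, hx]; ring⟩

/-- Here `4d + s = 2d + x` is positive, hence equals `2k + 1`, and `x > 0` leaves exactly `1 ≤ d ≤
k`. The index below is `d - 1`. -/
theorem sum_formTriples_eight_boundary_sq (k : ℕ) :
    ∑ p ∈ formTriples 8 ((2 * (k : ℤ) + 1) ^ 2) with Odd p.2.2 ∧ p.2.2 = 2 * p.2.1 + p.1,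
      2 * p.2.1 = k * (k + 1) := by
  have hsum : ∑ i ∈ Finset.range (k + 1), 2 * (i : ℤ) = k * (k + 1) := by
    induction k with
    | zero => simp
    | succ k ih =>
      rw [Finset.sum_range_succ, ih]
      push_cast
      ring
  rw [← hsum, Finset.sum_range_succ']
  simp only [Nat.cast_zero, mul_zero, add_zero]
  refine Finset.sum_nbij' (fun p => (p.2.1 - 1).toNat)
    (fun i => (2 * (k : ℤ) + 1 - 4 * (i + 1), (i : ℤ) + 1, 2 * (k : ℤ) + 1 - 2 * (i + 1)))
    ?_ ?_ ?_ ?_ ?_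
  · rintro ⟨s, d, x⟩ h
    simp only [Finset.mem_filter, mem_formTriples (show (0 : ℤ) < 8 by norm_num)] at h
    obtain ⟨⟨hd, hx, he⟩, _, rfl⟩ := h
    have : 4 * d + s = 2 * k + 1 := by
      refine (sq_eq_sq₀ (by omega) (by omega)).mp ?_
      rw [← he]
      ring
    simp only [Finset.mem_range]
    omega
  · intro i hi
    rw [Finset.mem_range] at hi
    simp only [Finset.mem_filter, mem_formTriples (show (0 : ℤ) < 8 by norm_num)]
    exact ⟨⟨by omega, by omega, by ring⟩, ⟨k - (i + 1), by ring⟩, by ring⟩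
  · rintro ⟨s, d, x⟩ h
    simp only [Finset.mem_filter, mem_formTriples (show (0 : ℤ) < 8 by norm_num)] at h
    obtain ⟨⟨hd, hx, he⟩, _, rfl⟩ := h
    have : 4 * d + s = 2 * k + 1 := by
      refine (sq_eq_sq₀ (by omega) (by omega)).mp ?_
      rw [← he]
      ring
    simp only [Prod.mk.injEq]
    omega
  · intro i _
    simp
  · rintro ⟨s, d, x⟩ h
    simp only [Finset.mem_filter, mem_formTriples (show (0 : ℤ) < 8 by norm_num)] at h
    simp only
    push_cast
    omega

open Classical in
theorem sum_range_sigmaQ_sub_triangular (n : ℕ) :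
    ∑ j ∈ Finset.range (4 * n + 1), (sigmaQ ((n : ℚ) - (j : ℚ) * ((j : ℚ) + 1) / 2) -
      4 * sigmaQ (((n : ℚ) - (j : ℚ) * ((j : ℚ) + 1) / 2) / 2)) =
    if ∃ k : ℕ, k * (k + 1) = 2 * n then (n : ℤ) else 0 := by
  have h8 := sum_formTriples_eq_two_mul_sum_range (k := 8) (by norm_num) (by norm_num) (4 * n)
    (w := fun _ => 1) (by simp)
  have h16 := sum_formTriples_eq_two_mul_sum_range (k := 16) (by norm_num) (by norm_num) (4 * n)
    (w := fun _ => 1) (by simp)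
  have h := sum_formTriples_eight_sub (2 * ((4 * n : ℕ) : ℤ) + 1) ⟨_, rfl⟩
  simp only [one_mul] at h8 h16
  rw [h8, h16] at h
  have e : ∑ j ∈ Finset.range (4 * n + 1), (sigmaQ ((n : ℚ) - (j : ℚ) * ((j : ℚ) + 1) / 2) -
      4 * sigmaQ (((n : ℚ) - (j : ℚ) * ((j : ℚ) + 1) / 2) / 2)) =
      ∑ j ∈ Finset.range (4 * n + 1),
        sigmaQ ((2 * ((4 * n : ℕ) : ℚ) + 1 - (2 * (j : ℚ) + 1) ^ 2) / (8 : ℤ)) -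
      4 * ∑ j ∈ Finset.range (4 * n + 1),
        sigmaQ ((2 * ((4 * n : ℕ) : ℚ) + 1 - (2 * (j : ℚ) + 1) ^ 2) / (16 : ℤ)) := by
    rw [Finset.sum_sub_distrib, Finset.mul_sum]
    congr 1 <;> refine Finset.sum_congr rfl fun j _ => ?_
    · congr 1
      push_cast
      ring
    · congr 2
      push_cast
      ring
  rw [e]
  split_ifs with hk
  · obtain ⟨k, hk⟩ := hk
    have hk' : (k : ℤ) * (k + 1) = 2 * n := by exact_mod_cast hk
    have hD : 2 * ((4 * n : ℕ) : ℤ) + 1 = (2 * (k : ℤ) + 1) ^ 2 := by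
      push_cast
      linear_combination -4 * hk'
    rw [hD, sum_formTriples_eight_boundary_sq, hk'] at h
    linarith
  · rw [sum_formTriples_eight_boundary_eq_zero] at h
    · linarith
    · rintro ⟨r, hr⟩
      apply hk
      have hodd : Odd (r.natAbs) := by
        rw [Int.natAbs_odd]
        have : Odd (r * r) := ⟨_, hr.symm⟩
        exact (Int.odd_mul.mp this).1
      obtain ⟨t, ht⟩ := hodd
      refine ⟨t, ?_⟩
      have h1 : r.natAbs * r.natAbs = 2 * (4 * n) + 1 := by
        zify
        rw [abs_mul_abs_self, ← hr]
        push_cast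
        ring
      rw [ht] at h1
      linarith

/-! ### Generating series over triangular numbers and recursion (iii) -/

theorem two_mul_triangular (j : ℕ) : 2 * (j * (j + 1) / 2) = j * (j + 1) :=
  Nat.mul_div_cancel' (Nat.even_mul_succ_self j).two_dvd

open Classical in
/-- The power series `∑ w m * q ^ m` over the triangular numbers `m`. -/
noncomputable def triangularSeries (w : ℕ → ℤ) : PowerSeries ℤ :=
  PowerSeries.mk fun m => if ∃ k : ℕ, k * (k + 1) = 2 * m then w m else 0

theorem coeff_triangularSeries_mul (w : ℕ → ℤ) (f : PowerSeries ℤ) {n N : ℕ} (hN : n < N) :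
    PowerSeries.coeff n (triangularSeries w * f) =
      ∑ j ∈ Finset.range N, if j * (j + 1) / 2 ≤ n then
        w (j * (j + 1) / 2) * PowerSeries.coeff (n - j * (j + 1) / 2) f else 0 := by
  classical
  rw [PowerSeries.coeff_mul, Finset.Nat.sum_antidiagonal_eq_sum_range_succ_mk]
  simp only [triangularSeries, PowerSeries.coeff_mk, ite_mul, zero_mul]
  rw [← Finset.sum_filter, ← Finset.sum_filter]
  symm
  refine Finset.sum_nbij (fun j => j * (j + 1) / 2) ?_ ?_ ?_ ?_
  · intro j hj
    simp only [Finset.mem_filter, Finset.mem_range] at hj ⊢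
    exact ⟨by omega, j, (two_mul_triangular j).symm⟩
  · intro i _ j _ hij
    simp only at hij
    have h : i * (i + 1) = j * (j + 1) := by
      rw [← two_mul_triangular i, ← two_mul_triangular j, hij]
    rcases lt_trichotomy i j with hlt | rfl | hlt
    · nlinarith
    · rfl
    · nlinarith
  · intro m hm
    simp only [Finset.coe_filter, Finset.mem_range, Set.mem_ofPred_eq] at hm
    obtain ⟨hmn, k, hk⟩ := hm
    have hkm : k * (k + 1) / 2 = m := by omega
    refine ⟨k, ?_, hkm⟩
    simp only [Finset.coe_filter, Finset.mem_range, Set.mem_ofPred_eq]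
    refine ⟨?_, by omega⟩
    rcases Nat.eq_zero_or_pos k with rfl | hk0
    · omega
    · nlinarith
  · intro j _
    rfl

theorem triangularSeries_one_mul_theta_sigma :
    triangularSeries (fun _ => 1) *
        PowerSeries.mk (fun m : ℕ => (m : ℤ) * sigmaQ (2 * (m : ℚ) + 1)) =
      4 * (triangularSeries (fun m => (m : ℤ)) *
        PowerSeries.mk (fun m : ℕ => sigmaQ (2 * (m : ℚ) + 1))) := by
  ext n
  have hN : n < 4 * n + 3 := by omega
  have h4 : ∀ f : PowerSeries ℤ, PowerSeries.coeff n (4 * f) = 4 * PowerSeries.coeff n f := by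
    intro f
    rw [show (4 : PowerSeries ℤ) = PowerSeries.C 4 from (map_ofNat PowerSeries.C 4).symm,
      PowerSeries.coeff_C_mul]
  rw [h4, coeff_triangularSeries_mul _ _ hN, coeff_triangularSeries_mul _ _ hN, Finset.mul_sum,
    ← sub_eq_zero, ← Finset.sum_sub_distrib]
  -- With `j(j+1) = 2t`, the factor `-2` turns `(n - t) - 4t` into the weight `10t - 2n` of (i).
  refine (mul_eq_zero_iff_left (show (-2 : ℤ) ≠ 0 by norm_num)).mp ?_
  rw [Finset.mul_sum]
  refine Eq.trans ?_ (sum_range_mul_sigmaQ_two_mul_add_one n)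
  refine Finset.sum_congr rfl fun j _ => ?_
  have ht := two_mul_triangular j
  generalize j * (j + 1) / 2 = t at ht
  have htq : (j : ℚ) * (j + 1) = 2 * t := by exact_mod_cast ht.symm
  have htz : (j : ℤ) * (j + 1) = 2 * t := by exact_mod_cast ht.symm
  rw [mul_assoc 5, htz, htq]
  split_ifs with hle
  · simp only [PowerSeries.coeff_mk]
    push_cast [Nat.cast_sub hle]
    rw [show 2 * ((n : ℚ) - t) + 1 = 2 * n + 1 - 2 * t by ring]
    ring
  · have hlt : (n : ℚ) + 1 ≤ t := by exact_mod_cast not_le.mp hle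
    rw [sigmaQ_of_nonpos (by linarith)]
    ring

theorem triangularSeries_one_mul_sigma_sub :
    triangularSeries (fun _ => 1) *
        PowerSeries.mk (fun m : ℕ => sigmaQ (m : ℚ) - 4 * sigmaQ ((m : ℚ) / 2)) =
      triangularSeries (fun m => (m : ℤ)) := by
  ext n
  rw [coeff_triangularSeries_mul _ _ (show n < 4 * n + 1 by omega), triangularSeries,
    PowerSeries.coeff_mk]
  classical
  trans if ∃ k : ℕ, k * (k + 1) = 2 * n then (n : ℤ) else 0
  · rw [← sum_range_sigmaQ_sub_triangular n]
    refine Finset.sum_congr rfl fun j _ => ?_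
    have ht := two_mul_triangular j
    generalize j * (j + 1) / 2 = t at ht
    have htq : (j : ℚ) * (j + 1) = 2 * t := by exact_mod_cast ht.symm
    rw [htq, mul_div_cancel_left₀ _ (two_ne_zero' ℚ)]
    split_ifs with hle
    · simp only [PowerSeries.coeff_mk]
      push_cast [Nat.cast_sub hle]
      ring
    · have hlt : (n : ℚ) + 1 ≤ t := by exact_mod_cast not_le.mp hle
      rw [sigmaQ_of_nonpos (by linarith), sigmaQ_of_nonpos (by linarith)]
      ring
  · congr

theorem theta_sigma_eq_mul :
    PowerSeries.mk (fun m : ℕ => (m : ℤ) * sigmaQ (2 * (m : ℚ) + 1)) =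
      4 * (PowerSeries.mk (fun m : ℕ => sigmaQ (m : ℚ) - 4 * sigmaQ ((m : ℚ) / 2)) *
        PowerSeries.mk (fun m : ℕ => sigmaQ (2 * (m : ℚ) + 1))) := by
  -- Constant coefficient 1 makes the series cancellable in the domain of integer power series.
  have hne : triangularSeries (fun _ => 1) ≠ 0 := by
    intro h
    have := congrArg (PowerSeries.coeff 0) h
    rw [triangularSeries, PowerSeries.coeff_mk, if_pos ⟨0, rfl⟩] at this
    simp at this
  refine mul_left_cancel₀ hne ?_
  rw [triangularSeries_one_mul_theta_sigma, ← triangularSeries_one_mul_sigma_sub]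
  ring

theorem sum_range_sigma_sub_mul (n : ℕ) :
    ∑ j ∈ Finset.range n, 4 * ((sigmaQ ((j + 1 : ℕ) : ℚ) - 4 * sigmaQ (((j + 1 : ℕ) : ℚ) / 2)) *
      sigmaQ (2 * (n : ℚ) + 1 - 2 * ((j + 1 : ℕ) : ℚ))) = n * sigmaQ (2 * (n : ℚ) + 1) := by
  have h := congrArg (PowerSeries.coeff n) theta_sigma_eq_mul
  rw [show (4 : PowerSeries ℤ) = PowerSeries.C 4 from (map_ofNat PowerSeries.C 4).symm,
    PowerSeries.coeff_C_mul, PowerSeries.coeff_mul,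
    Finset.Nat.sum_antidiagonal_eq_sum_range_succ_mk, Finset.sum_range_succ'] at h
  simp only [PowerSeries.coeff_mk, Nat.cast_zero, zero_div, sigmaQ_of_nonpos le_rfl, mul_zero,
    sub_zero, zero_mul, add_zero] at h
  rw [h, Finset.mul_sum]
  refine Finset.sum_congr rfl fun j hj => ?_
  have hle : j + 1 ≤ n := Finset.mem_range.mp hj
  rw [Nat.cast_sub hle]
  congr 3
  ring

/-! ### From finite to infinite sums -/

theorem hasSum_pnat_of_range {f : ℕ → ℤ} {a : ℤ} (N : ℕ)
    (hsum : ∑ j ∈ Finset.range N, f (j + 1) = a) (hzero : ∀ j, N ≤ j → f (j + 1) = 0) :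
    HasSum (fun j : ℕ+ => f j) a := by
  rw [← Equiv.pnatEquivNat.symm.hasSum_iff, ← hsum]
  refine hasSum_sum_of_ne_finset_zero fun j hj => ?_
  exact hzero j (by simpa using hj)

theorem theorem2 (n : ℕ) (hn : 0 < n) :
    HasSum
      (fun j : ℕ+ => (5 * (j : ℤ) * ((j : ℤ) + 1) - 2 * (n : ℤ)) *
        sigmaQ (2 * (n : ℚ) + 1 - (j : ℚ) * ((j : ℚ) + 1)))
      (2 * (n : ℤ) * sigmaQ (2 * (n : ℚ) + 1)) ∧
    (((∃ k : ℕ, (n : ℚ) = (k : ℚ) * ((k : ℚ) + 1) / 2) →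
        HasSum
          (fun j : ℕ => sigmaQ ((n : ℚ) - (j : ℚ) * ((j : ℚ) + 1) / 2) -
            4 * sigmaQ (((n : ℚ) - (j : ℚ) * ((j : ℚ) + 1) / 2) / 2))
          (n : ℤ)) ∧
      ((¬ ∃ k : ℕ, (n : ℚ) = (k : ℚ) * ((k : ℚ) + 1) / 2) →
        HasSum
          (fun j : ℕ => sigmaQ ((n : ℚ) - (j : ℚ) * ((j : ℚ) + 1) / 2) -
            4 * sigmaQ (((n : ℚ) - (j : ℚ) * ((j : ℚ) + 1) / 2) / 2))
          0)) ∧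
    HasSum
      (fun j : ℕ+ => 4 * ((sigmaQ (j : ℚ) - 4 * sigmaQ ((j : ℚ) / 2)) *
        sigmaQ (2 * (n : ℚ) + 1 - 2 * (j : ℚ))))
      ((n : ℤ) * sigmaQ (2 * (n : ℚ) + 1)) := by
  classical
  have htri : (∃ k : ℕ, (n : ℚ) = (k : ℚ) * ((k : ℚ) + 1) / 2) ↔ ∃ k : ℕ, k * (k + 1) = 2 * n := by
    refine exists_congr fun k => ?_
    rw [eq_div_iff two_ne_zero, eq_comm, mul_comm (n : ℚ)]
    exact_mod_cast Iff.rfl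
  have hii : HasSum
      (fun j : ℕ => sigmaQ ((n : ℚ) - (j : ℚ) * ((j : ℚ) + 1) / 2) -
        4 * sigmaQ (((n : ℚ) - (j : ℚ) * ((j : ℚ) + 1) / 2) / 2))
      (if ∃ k : ℕ, k * (k + 1) = 2 * n then (n : ℤ) else 0) := by
    rw [← sum_range_sigmaQ_sub_triangular n]
    refine hasSum_sum_of_ne_finset_zero fun j hj => ?_
    have hj' : (4 * n + 1 : ℚ) ≤ j := by exact_mod_cast not_lt.mp (by simpa using hj)
    have hn0 : (0 : ℚ) ≤ n := n.cast_nonneg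
    have hle : (n : ℚ) - (j : ℚ) * ((j : ℚ) + 1) / 2 ≤ 0 := by nlinarith
    rw [sigmaQ_of_nonpos hle, sigmaQ_of_nonpos (by linarith)]
    rfl
  refine ⟨?_, ⟨fun h => ?_, fun h => ?_⟩, ?_⟩
  · refine hasSum_pnat_of_range (f := fun j : ℕ => (5 * (j : ℤ) * ((j : ℤ) + 1) - 2 * (n : ℤ)) *
        sigmaQ (2 * (n : ℚ) + 1 - (j : ℚ) * ((j : ℚ) + 1))) (4 * n + 2) ?_ fun j hj => ?_
    · have h := sum_range_mul_sigmaQ_two_mul_add_one n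
      rw [Finset.sum_range_succ'] at h
      simp only [Nat.cast_zero, mul_zero, zero_mul, sub_zero, zero_sub] at h
      linarith
    · have hj' : (4 * n + 2 : ℚ) ≤ j := by exact_mod_cast hj
      have hn0 : (0 : ℚ) ≤ n := n.cast_nonneg
      rw [sigmaQ_of_nonpos, mul_zero]
      push_cast
      nlinarith
  · rwa [if_pos (htri.mp h)] at hii
  · rwa [if_neg (mt htri.mpr h)] at hii
  · refine hasSum_pnat_of_range (f := fun j : ℕ => 4 * ((sigmaQ (j : ℚ) -
        4 * sigmaQ ((j : ℚ) / 2)) * sigmaQ (2 * (n : ℚ) + 1 - 2 * (j : ℚ)))) n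
        (sum_range_sigma_sub_mul n) fun j hj => ?_
    have hj' : (n : ℚ) ≤ j := by exact_mod_cast hj
    rw [sigmaQ_of_nonpos (x := 2 * (n : ℚ) + 1 - 2 * ((j + 1 : ℕ) : ℚ)), mul_zero, mul_zero]
    push_cast
    linarith
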